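/- Let $n\ge 0$ and let $f(z)=\sum_{\alpha\in A}c_\alpha z^\alpha\in\mathbb{C}[z_1^{\pm1},\dots,z_n^{\pm1}]$ be a Laurent polynomial, where $A\subset\mathbb{Z}^n$ is finite and $c_\alpha\in\mathbb{C}^*$ for $\alpha\in A$. Let $\mathbf{T}^n=(\mathbb{R}/2\pi\mathbb{Z})^n$. The coamoeba $\mathcal{A}'(f)\subset\mathbf{T}^n$ is the image of the zero set $\{z\in(\mathbb{C}^*)^n : f(z)=0\}$ under $z\mapsto(\arg z_1,\dots,\arg z_n)$. For $\theta\in\mathbf{T}^n$ put $f\langle\theta\rangle=\{e^{i(\arg c_\alpha+\langle\alpha,\theta\rangle)} : \alpha\in A\}$, and call it lopsided if there is a half-plane $H=\{w\in\mathbb{C} : \operatorname{Re}(e^{i\phi}w)>0\}$, $\phi\in\mathbb{R}$, such that $f\langle\theta\rangle\subset\overline{H}$ but $f\langle\theta\rangle\not\subset\partial H$. The lopsided coamoeba $\mathcal{LA}'(f)$ is the set of all $\theta\in\mathbf{T}^n$ for which $f\langle\theta\rangle$ is not lopsided. Then each connected component of the complement $\mathbf{T}^n\setminus\overline{\mathcal{A}'(f)}$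 of the closed coamoeba contains at most one connected component of the complement $\mathbf{T}^n\setminus\overline{\mathcal{LA}'(f)}$ of the closed lopsided coamoeba. -/

import Mathlib

namespace Coamoeba

/-- The real `n`-torus `(ℝ / 2πℤ)ⁿ`. -/
abbrev Torus (n : ℕ) : Type := Fin n → Real.Angle

/-- Complex Laurent polynomials in `n` variables: finite linear combinations of the monomials
`z ^ α`, `α ∈ ℤⁿ`. The index set `A` of a polynomial is the support of its coefficients. -/
abbrev LaurentPoly (n : ℕ) : Type := AddMonoidAlgebra ℂ (Fin n → ℤ)

/-- The value `f(z) = ∑_{α ∈ A} c_α z₁ ^ α₁ ⋯ zₙ ^ αₙ`, for `z` in the complex torus `(ℂ*)ⁿ`. -/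
noncomputable def eval {n : ℕ} (f : LaurentPoly n) (z : Fin n → ℂˣ) : ℂ :=
  ∑ α ∈ f.coeff.support, f.coeff α * ∏ i, ((z i : ℂ) ^ (α i))

/-- The componentwise argument `(ℂ*)ⁿ → (ℝ / 2πℤ)ⁿ`. -/
noncomputable def argMap {n : ℕ} (z : Fin n → ℂˣ) : Torus n :=
  fun i => (Complex.arg (z i : ℂ) : Real.Angle)

/-- The coamoeba of `f`: the image under the argument map of the zero locus of `f` in
`(ℂ*)ⁿ`. -/
def coamoeba {n : ℕ} (f : LaurentPoly n) : Set (Torus n) :=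
  argMap '' {z | eval f z = 0}

/-- The open half-plane `H_φ = {z ∈ ℂ | Re (e^{iφ} z) > 0}`. -/
def halfSpace (φ : ℝ) : Set ℂ :=
  {z | 0 < (Complex.exp (φ * Complex.I) * z).re}

/-- The set `f⟨θ⟩` of the phases `e^{i (arg c_α + ⟨α, θ⟩)}`, `α ∈ A`, on the unit circle. -/
noncomputable def phases {n : ℕ} (f : LaurentPoly n) (θ : Torus n) : Set ℂ :=
  (fun α : Fin n → ℤ =>
    ((((Complex.arg (f.coeff α) : Real.Angle) + ∑ i, α i • θ i).toCircle : Circle) : ℂ)) ''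
      (f.coeff.support : Set (Fin n → ℤ))

/-- A set of complex numbers is lopsided if it lies in some closed half-plane (with the origin
on the boundary) without lying entirely in the boundary line of that half-plane. -/
def IsLopsided (S : Set ℂ) : Prop :=
  ∃ φ : ℝ, S ⊆ closure (halfSpace φ) ∧ ¬ S ⊆ frontier (halfSpace φ)

/-- The lopsided coamoeba of `f`: the points `θ` for which `f⟨θ⟩` is not lopsided. -/
def lopsidedCoamoeba {n : ℕ} (f : LaurentPoly n) : Set (Torus n) :=
  {θ | ¬ IsLopsided (phases f θ)}

/-- The connected components of the complement of a subset of a topological space. -/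
def complementComponents {X : Type*} [TopologicalSpace X] (S : Set X) : Set (Set X) :=
  {E | ∃ x ∈ Sᶜ, E = connectedComponentIn Sᶜ x}

end Coamoeba

namespace Coamoeba
open Complex

/-! ### Lifting to the universal cover -/

/-! Off the closed lopsided coamoeba all phases lie in a common open half-plane
(`strictlyLopsidedAt_of_notMem_closure`), and conversely once `f` is nonzero. Join two such points
by a path off the coamoeba and lift it to `θ` in `ℝⁿ`. Then `f (e ^ (u + i θ t))` never vanishes and
has a continuous logarithm in `(u, t)`. At each end its imaginary part selects an integer branch of
every phase (`exists_branches`).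

For a vertex `v` of the Newton polytope, some `u` makes the monomial of `v` dominate for all
arguments, so the logarithm follows that phase along the path and the two branches of `v` agree. The
difference of the end phases is affine in the exponent, so a bound by `π` at the vertices holds on
the whole polytope (`abs_add_pairing_lt`), which forces all branches to agree. Interpolating
linearly then keeps the phases in open half-planes, so the straight segment avoids the closed
lopsided coamoeba. -/

/-- The projection `ℝⁿ → (ℝ / 2πℤ)ⁿ`. -/
noncomputable def toTorus {n : ℕ} (x : Fin n → ℝ) : Torus n := fun i => (x i : Real.Angle)

theorem continuous_toTorus {n : ℕ} : Continuous (toTorus (n := n)) :=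
  continuous_pi fun i => Real.Angle.continuous_coe.comp (continuous_apply i)

/-- The pairing of an integer exponent with a real vector. -/
def pairing {n : ℕ} (α : Fin n → ℤ) (x : Fin n → ℝ) : ℝ := ∑ i, (α i : ℝ) * x i

theorem continuous_pairing {n : ℕ} (α : Fin n → ℤ) : Continuous (pairing α) := by
  unfold pairing; fun_prop

theorem pairing_add {n : ℕ} (α : Fin n → ℤ) (x y : Fin n → ℝ) :
    pairing α (x + y) = pairing α x + pairing α y := by
  simp [pairing, mul_add, Finset.sum_add_distrib]

theorem pairing_smul {n : ℕ} (α : Fin n → ℤ) (r : ℝ) (x : Fin n → ℝ) :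
    pairing α (r • x) = r * pairing α x := by
  simp only [pairing, Pi.smul_apply, smul_eq_mul, Finset.mul_sum]
  exact Finset.sum_congr rfl fun i _ => by ring

/-- The real-valued lift of the phase of the monomial `c_α z ^ α`. -/
noncomputable def phaseAngle {n : ℕ} (f : LaurentPoly n) (α : Fin n → ℤ) (x : Fin n → ℝ) : ℝ :=
  arg (f.coeff α) + pairing α x

theorem continuous_phaseAngle {n : ℕ} (f : LaurentPoly n) (α : Fin n → ℤ) :
    Continuous (phaseAngle f α) :=
  continuous_const.add (continuous_pairing α)

theorem phaseAngle_add {n : ℕ} (f : LaurentPoly n) (α : Fin n → ℤ) (x y : Fin n → ℝ) :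
    phaseAngle f α (x + y) = phaseAngle f α x + pairing α y := by
  simp [phaseAngle, pairing_add, add_assoc]

theorem phases_toTorus {n : ℕ} (f : LaurentPoly n) (x : Fin n → ℝ) :
    phases f (toTorus x) =
      (fun α => exp (phaseAngle f α x * I)) '' (f.coeff.support : Set (Fin n → ℤ)) := by
  unfold phases
  refine Set.image_congr fun α _ => ?_
  have : (arg (f.coeff α) : Real.Angle) + ∑ i, α i • toTorus x i
      = (phaseAngle f α x : Real.Angle) := by
    simp only [phaseAngle, pairing, toTorus, Real.Angle.coe_add]
    congr 1
    rw [← Real.Angle.coe_coeHom, map_sum]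
    refine Finset.sum_congr rfl fun i _ => ?_
    rw [Real.Angle.coe_coeHom, ← Real.Angle.coe_zsmul, zsmul_eq_mul]
  rw [this, Real.Angle.toCircle_coe, Circle.coe_exp]

theorem re_exp_mul_exp (φ a : ℝ) : (exp (φ * I) * exp (a * I)).re = Real.cos (φ + a) := by
  rw [← exp_add, ← add_mul, ← ofReal_add, exp_ofReal_mul_I_re]

/-- All phases over `x` lie in a common open half-plane. -/
def StrictlyLopsidedAt {n : ℕ} (f : LaurentPoly n) (x : Fin n → ℝ) : Prop :=
  ∃ φ : ℝ, ∀ α ∈ f.coeff.support, 0 < Real.cos (φ + phaseAngle f α x)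

/-! ### Half-planes -/

theorem continuous_re_exp_mul (φ : ℝ) :
    Continuous fun z : ℂ => (exp (φ * I) * z).re := by fun_prop

theorem isOpen_halfSpace (φ : ℝ) : IsOpen (halfSpace φ) :=
  isOpen_lt continuous_const (continuous_re_exp_mul φ)

theorem re_nonneg_of_mem_closure_halfSpace {φ : ℝ} {z : ℂ} (hz : z ∈ closure (halfSpace φ)) :
    0 ≤ (exp (φ * I) * z).re :=
  have hcl : IsClosed {z : ℂ | 0 ≤ (exp (φ * I) * z).re} :=
    isClosed_le continuous_const (continuous_re_exp_mul φ)
  have hsub : halfSpace φ ⊆ {z : ℂ | 0 ≤ (exp (φ * I) * z).re} := fun w hw =>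
    le_of_lt (show 0 < (exp (φ * I) * w).re from hw)
  closure_minimal hsub hcl hz

theorem isLopsided_of_subset_halfSpace {S : Set ℂ} (hS : S.Nonempty) {φ : ℝ}
    (h : S ⊆ halfSpace φ) : IsLopsided S := by
  refine ⟨φ, h.trans subset_closure, fun hf => ?_⟩
  obtain ⟨w, hw⟩ := hS
  have := hf hw
  rw [(isOpen_halfSpace φ).frontier_eq] at this
  exact this.2 (h hw)

theorem IsLopsided.exists_re {S : Set ℂ} (h : IsLopsided S) :
    ∃ φ : ℝ, (∀ w ∈ S, 0 ≤ (exp (φ * I) * w).re) ∧ ∃ w ∈ S, 0 < (exp (φ * I) * w).re := by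
  obtain ⟨φ, h1, h2⟩ := h
  refine ⟨φ, fun w hw => re_nonneg_of_mem_closure_halfSpace (h1 hw), ?_⟩
  obtain ⟨w, hw, hwf⟩ := Set.not_subset.1 h2
  refine ⟨w, hw, ?_⟩
  by_contra hn
  refine hwf ?_
  rw [(isOpen_halfSpace φ).frontier_eq]
  exact ⟨h1 hw, hn⟩

theorem exists_cos_of_notMem_lopsidedCoamoeba {n : ℕ} {f : LaurentPoly n} {x : Fin n → ℝ}
    (h : toTorus x ∉ lopsidedCoamoeba f) :
    ∃ φ : ℝ, (∀ α ∈ f.coeff.support, 0 ≤ Real.cos (φ + phaseAngle f α x)) ∧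
      ∃ α ∈ f.coeff.support, 0 < Real.cos (φ + phaseAngle f α x) := by
  obtain ⟨φ, h1, w, hw, h2⟩ := IsLopsided.exists_re (not_not.1 h)
  rw [phases_toTorus] at h1 hw
  obtain ⟨α, hα, rfl⟩ := hw
  refine ⟨φ, fun β hβ => ?_, α, hα, ?_⟩
  · rw [← re_exp_mul_exp]; exact h1 _ ⟨β, hβ, rfl⟩
  · rwa [← re_exp_mul_exp]

/-- For a fixed `φ`, strictness is an open condition on finitely many continuous phases. The support
must be nonempty because the empty set is not lopsided. -/
theorem StrictlyLopsidedAt.notMem_closure {n : ℕ} {f : LaurentPoly n} {x : Fin n → ℝ}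
    (hf : f.coeff.support.Nonempty) (h : StrictlyLopsidedAt f x) :
    toTorus x ∉ closure (lopsidedCoamoeba f) := by
  obtain ⟨φ, hφ⟩ := h
  let g : (Fin n → ℤ) → Torus n → ℂ := fun α θ =>
    ((((arg (f.coeff α) : Real.Angle) + ∑ i, α i • θ i).toCircle : Circle) : ℂ)
  have hg : ∀ α, Continuous (g α) := fun α => by
    have hc : Continuous Real.Angle.toCircle :=
      continuous_coinduced_dom.2 Circle.exp.continuous
    have hi : ∀ i, Continuous fun θ : Torus n => α i • θ i := fun i => by
      have : Continuous fun θ : Torus n => θ i := continuous_apply i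
      exact this.zsmul (α i)
    have ha : Continuous fun θ : Torus n =>
        (arg (f.coeff α) : Real.Angle) + ∑ i, α i • θ i :=
      continuous_const.add (continuous_finsetSum _ fun i _ => hi i)
    exact continuous_subtype_val.comp (hc.comp ha)
  let U : Set (Torus n) := ⋂ α ∈ f.coeff.support, g α ⁻¹' halfSpace φ
  have hU : IsOpen U :=
    isOpen_biInter_finset fun α _ => (isOpen_halfSpace φ).preimage (hg α)
  have hxU : toTorus x ∈ U := by
    refine Set.mem_iInter₂.2 fun α hα => ?_
    have h1 : g α (toTorus x) ∈ phases f (toTorus x) := ⟨α, hα, rfl⟩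
    rw [phases_toTorus] at h1
    obtain ⟨β, hβ, h2⟩ := h1
    change 0 < (exp (φ * I) * g α (toTorus x)).re
    rw [← h2, re_exp_mul_exp]
    exact hφ β hβ
  intro hcl
  obtain ⟨θ, hθU, hθ⟩ := mem_closure_iff.1 hcl U hU hxU
  refine hθ (isLopsided_of_subset_halfSpace (φ := φ) (hf.to_set.image _) ?_)
  rintro _ ⟨α, hα, rfl⟩
  exact Set.mem_iInter₂.1 hθU α hα

/-! ### Points outside the closed lopsided coamoeba are strictly lopsided -/

/-- Three directions that positively span the plane do not lie in a closed half-plane. -/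
theorem exists_cos_neg_of_sin_pos {a b c : ℝ} (h1 : 0 < Real.sin (b - c))
    (h2 : 0 < Real.sin (c - a)) (h3 : 0 < Real.sin (a - b)) (φ : ℝ) :
    Real.cos (φ + a) < 0 ∨ Real.cos (φ + b) < 0 ∨ Real.cos (φ + c) < 0 := by
  by_contra! h
  obtain ⟨ha, hb, hc⟩ := h
  -- The origin is a combination of the three directions with these positive weights, so nonnegative
  -- cosines must all vanish.
  have key : Real.sin (b - c) * Real.cos (φ + a) + Real.sin (c - a) * Real.cos (φ + b)
      + Real.sin (a - b) * Real.cos (φ + c) = 0 := by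
    simp only [Real.sin_sub, Real.cos_add]; ring
  have e1 := mul_nonneg h1.le ha
  have e2 := mul_nonneg h2.le hb
  have e3 := mul_nonneg h3.le hc
  have ha0 : Real.cos (φ + a) = 0 := by
    rcases mul_eq_zero.1 (show Real.sin (b - c) * Real.cos (φ + a) = 0 by linarith) with h | h
    · exact absurd h h1.ne'
    · exact h
  have hb0 : Real.cos (φ + b) = 0 := by
    rcases mul_eq_zero.1 (show Real.sin (c - a) * Real.cos (φ + b) = 0 by linarith) with h | h
    · exact absurd h h2.ne'
    · exact h
  have : Real.sin (a - b) = 0 := by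
    rw [show a - b = (φ + a) - (φ + b) by ring, Real.sin_sub, ha0, hb0]; ring
  exact h3.ne' this

/-- A configuration in a closed half-plane all of whose boundary points are on the same side
can be rotated into the open half-plane. -/
theorem exists_forall_cos_pos_of_sin_pos {ι : Type*} (s : Finset ι) (p : ι → ℝ) (φ σ : ℝ)
    (h : ∀ k ∈ s, 0 ≤ Real.cos (φ + p k))
    (hs : ∀ k ∈ s, Real.cos (φ + p k) = 0 → 0 < σ * Real.sin (φ + p k)) :
    ∃ ψ : ℝ, ∀ k ∈ s, 0 < Real.cos (ψ + p k) := by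
  have key : ∀ k ∈ s, ∀ᶠ ε : ℝ in nhdsWithin 0 (Set.Ioi 0),
      0 < Real.cos (φ + p k) + ε * (σ * Real.sin (φ + p k)) := by
    intro k hk
    rcases (h k hk).lt_or_eq with h0 | h0
    · have hc : Continuous fun ε : ℝ =>
          Real.cos (φ + p k) + ε * (σ * Real.sin (φ + p k)) := by fun_prop
      exact nhdsWithin_le_nhds (hc.continuousAt.eventually
        (isOpen_Ioi.mem_nhds (show _ ∈ Set.Ioi (0 : ℝ) by simpa using h0)))
    · filter_upwards [self_mem_nhdsWithin] with ε hε
      rw [← h0, zero_add]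
      exact mul_pos hε (hs k hk h0.symm)
  obtain ⟨ε, hε⟩ := ((Filter.eventually_all_finset s).2 key).exists
  -- With `s = ε * σ`, `cos (y - arctan s)` is `cos y + s * sin y` times the positive factor `cos
  -- (arctan s)`.
  refine ⟨φ - Real.arctan (ε * σ), fun k hk => ?_⟩
  have hc := Real.cos_arctan_pos (ε * σ)
  have ht := Real.tan_mul_cos hc.ne'
  rw [Real.tan_arctan] at ht
  rw [show φ - Real.arctan (ε * σ) + p k = (φ + p k) - Real.arctan (ε * σ) by ring,
    Real.cos_sub, ← ht]
  have := mul_pos (hε k hk) hc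
  linarith

theorem pairing_sub_pos {n : ℕ} {α β : Fin n → ℤ} (h : α ≠ β) :
    0 < pairing α (fun i => (α i : ℝ) - β i) - pairing β (fun i => (α i : ℝ) - β i) := by
  have : pairing α (fun i => (α i : ℝ) - β i) - pairing β (fun i => (α i : ℝ) - β i)
      = ∑ i, ((α i : ℝ) - β i) ^ 2 := by
    simp only [pairing, ← Finset.sum_sub_distrib]
    exact Finset.sum_congr rfl fun i _ => by ring
  rw [this]
  obtain ⟨i, hi⟩ := Function.ne_iff.1 h
  refine Finset.sum_pos' (fun i _ => sq_nonneg _) ⟨i, Finset.mem_univ i, ?_⟩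
  have : (α i : ℝ) - β i ≠ 0 := sub_ne_zero.2 (by exact_mod_cast hi)
  positivity

/-- If strictness fails, two phases are antipodal on the boundary line and a third is strictly
inside. Arbitrarily small moves of `x` open the antipodal pair beyond `π`; the three phases then
positively span the plane, so `x` lies over the closure. -/
theorem strictlyLopsidedAt_of_notMem_closure {n : ℕ} {f : LaurentPoly n} {x : Fin n → ℝ}
    (h : toTorus x ∉ closure (lopsidedCoamoeba f)) : StrictlyLopsidedAt f x := by
  obtain ⟨φ, hφ, m, hm, hm0⟩ :=
    exists_cos_of_notMem_lopsidedCoamoeba fun hx => h (subset_closure hx)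
  by_contra hns
  have hside : ∀ σ : ℝ, ∃ k ∈ f.coeff.support, Real.cos (φ + phaseAngle f k x) = 0 ∧
      σ * Real.sin (φ + phaseAngle f k x) ≤ 0 := by
    intro σ
    by_contra! hσ
    exact hns (exists_forall_cos_pos_of_sin_pos _ (fun α => phaseAngle f α x) φ σ hφ hσ)
  obtain ⟨l, hl, hlc, hls⟩ := hside 1
  obtain ⟨k, hk, hkc, hks⟩ := hside (-1)
  have hl2 := Real.sin_sq_add_cos_sq (φ + phaseAngle f l x)
  have hk2 := Real.sin_sq_add_cos_sq (φ + phaseAngle f k x)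
  have hls : Real.sin (φ + phaseAngle f l x) = -1 := by
    rw [hlc] at hl2; nlinarith
  have hks : Real.sin (φ + phaseAngle f k x) = 1 := by
    rw [hkc] at hk2; nlinarith
  have hkl : k ≠ l := by rintro rfl; linarith
  -- Moving along `k - l` increases the phase gap between `k` and `l` at rate `|k - l|²`.
  let v : Fin n → ℝ := fun i => (k i : ℝ) - l i
  have hv : 0 < pairing k v - pairing l v := pairing_sub_pos hkl
  let y : ℝ → Fin n → ℝ := fun ε => x + ε • v
  have hy : Continuous y := by fun_prop
  have hy0 : y 0 = x := by simp [y]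
  have hP : ∀ α, Continuous fun ε => phaseAngle f α (y ε) :=
    fun α => (continuous_phaseAngle f α).comp hy
  have ev1 : ∀ᶠ ε in nhdsWithin (0 : ℝ) (Set.Ioi 0),
      0 < Real.sin (phaseAngle f m (y ε) - phaseAngle f l (y ε)) := by
    have hc := Real.continuous_sin.comp ((hP m).sub (hP l))
    refine nhdsWithin_le_nhds (hc.continuousAt.eventually (isOpen_Ioi.mem_nhds ?_))
    change 0 < Real.sin (phaseAngle f m (y 0) - phaseAngle f l (y 0))
    rw [hy0, show phaseAngle f m x - phaseAngle f l x
      = (φ + phaseAngle f m x) - (φ + phaseAngle f l x) by ring, Real.sin_sub, hlc, hls]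
    linarith
  have ev2 : ∀ᶠ ε in nhdsWithin (0 : ℝ) (Set.Ioi 0),
      0 < Real.sin (phaseAngle f k (y ε) - phaseAngle f m (y ε)) := by
    have hc := Real.continuous_sin.comp ((hP k).sub (hP m))
    refine nhdsWithin_le_nhds (hc.continuousAt.eventually (isOpen_Ioi.mem_nhds ?_))
    change 0 < Real.sin (phaseAngle f k (y 0) - phaseAngle f m (y 0))
    rw [hy0, show phaseAngle f k x - phaseAngle f m x
      = (φ + phaseAngle f k x) - (φ + phaseAngle f m x) by ring, Real.sin_sub, hkc, hks]
    linarith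
  have ev3 : ∀ᶠ ε in nhdsWithin (0 : ℝ) (Set.Ioi 0),
      0 < Real.sin (phaseAngle f l (y ε) - phaseAngle f k (y ε)) := by
    have hsmall : ∀ᶠ ε in nhdsWithin (0 : ℝ) (Set.Ioi 0),
        ε * (pairing k v - pairing l v) < Real.pi := by
      have hc : Continuous fun ε : ℝ => ε * (pairing k v - pairing l v) := by fun_prop
      refine nhdsWithin_le_nhds (hc.continuousAt.eventually (isOpen_Iio.mem_nhds ?_))
      simpa using Real.pi_pos
    filter_upwards [hsmall, self_mem_nhdsWithin] with ε h1 h2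
    have e : phaseAngle f l (y ε) - phaseAngle f k (y ε)
        = ((φ + phaseAngle f l x) - (φ + phaseAngle f k x))
          - ε * (pairing k v - pairing l v) := by
      simp only [y, phaseAngle_add, pairing_smul]; ring
    have := Real.sin_pos_of_pos_of_lt_pi (mul_pos h2 hv) h1
    rw [e, Real.sin_sub, Real.sin_sub, Real.cos_sub, hlc, hls, hkc, hks]
    linarith
  have hmem : ∀ᶠ ε in nhdsWithin (0 : ℝ) (Set.Ioi 0), toTorus (y ε) ∈ lopsidedCoamoeba f := by
    filter_upwards [ev1, ev2, ev3] with ε h1 h2 h3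
    by_contra hn
    obtain ⟨ψ, hψ, -⟩ := exists_cos_of_notMem_lopsidedCoamoeba hn
    rcases exists_cos_neg_of_sin_pos h1 h3 h2 ψ with h | h | h
    · exact absurd (hψ k hk) (not_le.2 h)
    · exact absurd (hψ m hm) (not_le.2 h)
    · exact absurd (hψ l hl) (not_le.2 h)
  refine h (mem_closure_of_tendsto (b := nhdsWithin (0 : ℝ) (Set.Ioi 0))
    (f := fun ε => toTorus (y ε)) ?_ hmem)
  have := ((continuous_toTorus.comp hy).tendsto 0).mono_left
    (nhdsWithin_le_nhds (s := Set.Ioi 0))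
  simpa [hy0, Function.comp_def] using this


/-! ### Continuous logarithms and arguments -/

theorem exists_continuous_log {X : Type*} [TopologicalSpace X] [SimplyConnectedSpace X]
    [LocallyPathConnectedSpace X] {F : X → ℂ} (hF : Continuous F) (h0 : ∀ x, F x ≠ 0) :
    ∃ L : X → ℂ, Continuous L ∧ ∀ x, exp (L x) = F x := by
  obtain ⟨x₀⟩ : Nonempty X := inferInstance
  obtain ⟨L, ⟨-, hL⟩, -⟩ := isCoveringMapOn_exp.existsUnique_continuousMap_lifts
    ⟨F, hF⟩ (a₀ := x₀) (exp_log (h0 x₀)) h0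
  exact ⟨L, L.continuous, fun x => congrFun hL x⟩

theorem exists_toTorus_lift {n : ℕ} {γ : ℝ → Torus n} (hγ : Continuous γ) :
    ∃ θ : ℝ → Fin n → ℝ, Continuous θ ∧ ∀ t, toTorus (θ t) = γ t := by
  have h : ∀ i, ∃ g : ℝ → ℝ, Continuous g ∧ ∀ t, (g t : Real.Angle) = γ t i := by
    intro i
    have hc : Continuous fun t => γ t i := (continuous_apply i).comp hγ
    obtain ⟨g, ⟨-, hg⟩, -⟩ :=
      (AddCircle.isCoveringMap_coe (2 * Real.pi)).existsUnique_continuousMap_lifts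
        (⟨fun t => γ t i, hc⟩ : C(ℝ, AddCircle (2 * Real.pi))) 0 ((γ 0 i).toReal)
        (Real.Angle.coe_toReal (γ 0 i))
    exact ⟨g, g.continuous, fun t => congrFun hg t⟩
  choose g hg hgγ using h
  exact ⟨fun t i => g i t, continuous_pi hg, fun t => funext fun i => hgγ i t⟩

theorem exists_int_abs_sub_lt_of_cos_pos {y : ℝ} (h : 0 < Real.cos y) :
    ∃ m : ℤ, |y - 2 * Real.pi * m| < Real.pi / 2 := by
  refine ⟨toIocDiv Real.two_pi_pos (-Real.pi) y, ?_⟩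
  set m := toIocDiv Real.two_pi_pos (-Real.pi) y
  have h1 := toIocMod_mem_Ioc Real.two_pi_pos (-Real.pi) y
  have h2 : toIocMod Real.two_pi_pos (-Real.pi) y = y - 2 * Real.pi * m := by
    rw [toIocMod, zsmul_eq_mul]; ring
  rw [h2] at h1
  have h3 : 0 < Real.cos (y - 2 * Real.pi * m) := by
    rwa [mul_comm, Real.cos_sub_int_mul_two_pi]
  by_contra hn
  rw [← Real.cos_abs] at h3
  refine absurd h3 (not_lt.2 (Real.cos_nonpos_of_pi_div_two_le_of_le (not_lt.1 hn) ?_))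
  have : |y - 2 * Real.pi * m| ≤ Real.pi := abs_le.2 ⟨h1.1.le, by linarith [h1.2]⟩
  linarith [Real.pi_pos]

theorem int_eq_of_abs_two_pi_mul_sub_lt {a b : ℤ}
    (h : |2 * Real.pi * a - 2 * Real.pi * b| < 2 * Real.pi) : a = b := by
  rw [← mul_sub, abs_mul, abs_of_pos Real.two_pi_pos] at h
  have h1 : |(a : ℝ) - b| < 1 := by
    by_contra hn
    nlinarith [Real.two_pi_pos, not_lt.1 hn]
  have h2 : |a - b| < 1 := by exact_mod_cast h1
  exact sub_eq_zero.1 (Int.abs_lt_one_iff.1 h2)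

/-- The nearest multiple of `2π` is locally constant, since `g` cannot jump between the disjoint
intervals where cosine is positive. -/
theorem exists_int_forall_abs_sub_lt_of_cos_pos {X : Type*} [TopologicalSpace X]
    [PreconnectedSpace X] {g : X → ℝ} (hg : Continuous g) (h : ∀ x, 0 < Real.cos (g x)) :
    ∃ m : ℤ, ∀ x, |g x - 2 * Real.pi * m| < Real.pi / 2 := by
  choose m hm using fun x => exists_int_abs_sub_lt_of_cos_pos (h x)
  have hlc : IsLocallyConstant m := by
    refine (IsLocallyConstant.iff_eventually_eq m).2 fun x => ?_
    have hev : ∀ᶠ y in nhds x, |g y - g x| < Real.pi := by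
      have hc : Continuous fun y => |g y - g x| := by fun_prop
      refine hc.continuousAt.eventually (isOpen_Iio.mem_nhds ?_)
      simpa using Real.pi_pos
    filter_upwards [hev] with y hy
    refine int_eq_of_abs_two_pi_mul_sub_lt ?_
    have h1 := abs_lt.1 (hm x)
    have h2 := abs_lt.1 (hm y)
    have h3 := abs_lt.1 hy
    exact abs_lt.2 ⟨by linarith, by linarith⟩
  rcases isEmpty_or_nonempty X with hX | ⟨⟨x₀⟩⟩
  · exact ⟨0, fun x => (hX.false x).elim⟩
  · refine ⟨m x₀, fun x => ?_⟩
    rw [hlc.apply_eq_of_isPreconnected isPreconnected_univ (Set.mem_univ x₀) (Set.mem_univ x)]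
    exact hm x

/-! ### The polynomial in polar coordinates -/

/-- The value of `f` at the point with log-moduli `u` and arguments `x`. -/
noncomputable def evalPolar {n : ℕ} (f : LaurentPoly n) (u x : Fin n → ℝ) : ℂ :=
  ∑ α ∈ f.coeff.support,
    ((‖f.coeff α‖ * Real.exp (pairing α u) : ℝ) : ℂ) * exp (phaseAngle f α x * I)

theorem continuous_evalPolar {n : ℕ} (f : LaurentPoly n) {X : Type*} [TopologicalSpace X]
    {u x : X → Fin n → ℝ} (hu : Continuous u) (hx : Continuous x) :
    Continuous fun t => evalPolar f (u t) (x t) := by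
  unfold evalPolar
  refine continuous_finsetSum _ fun α _ => ?_
  have h1 := (continuous_pairing α).comp hu
  have h2 := (continuous_phaseAngle f α).comp hx
  simp only [Function.comp_def] at h1 h2
  fun_prop

/-- The point of the complex torus with log-moduli `u` and arguments `x`. -/
noncomputable def polarPoint {n : ℕ} (u x : Fin n → ℝ) : Fin n → ℂˣ :=
  fun i => Units.mk0 (exp (u i + x i * I)) (exp_ne_zero _)

theorem eval_polarPoint {n : ℕ} (f : LaurentPoly n) (u x : Fin n → ℝ) :
    eval f (polarPoint u x) = evalPolar f u x := by
  refine Finset.sum_congr rfl fun α _ => ?_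
  have h1 : ∏ i, (((polarPoint u x) i : ℂ) ^ (α i))
      = exp (pairing α u) * exp (pairing α x * I) := by
    simp only [polarPoint, Units.val_mk0, ← exp_int_mul, ← exp_sum, ← exp_add]
    congr 1
    simp only [pairing, ofReal_sum, Finset.sum_mul, ← Finset.sum_add_distrib]
    refine Finset.sum_congr rfl fun i _ => ?_
    push_cast; ring
  rw [h1]
  conv_lhs => rw [← norm_mul_exp_arg_mul_I (f.coeff α)]
  simp only [phaseAngle, ofReal_add, ofReal_mul, ofReal_exp, add_mul, exp_add]
  ring

theorem argMap_polarPoint {n : ℕ} (u x : Fin n → ℝ) : argMap (polarPoint u x) = toTorus x := by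
  funext i
  simp only [argMap, polarPoint, Units.val_mk0, toTorus]
  rw [exp_add, ← ofReal_exp, arg_real_mul _ (Real.exp_pos _), arg_exp_mul_I,
    Real.Angle.coe_toIocMod]

theorem evalPolar_ne_zero {n : ℕ} {f : LaurentPoly n} {x : Fin n → ℝ}
    (h : toTorus x ∉ coamoeba f) (u : Fin n → ℝ) : evalPolar f u x ≠ 0 := fun h0 =>
  h ⟨polarPoint u x, (eval_polarPoint f u x).trans h0, argMap_polarPoint u x⟩

theorem cos_add_im_pos_of_re_pos {w : ℂ} {φ : ℝ} (h : 0 < (exp (φ * I) * exp w).re) :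
    0 < Real.cos (φ + w.im) := by
  rw [← exp_add, exp_re] at h
  have := pos_of_mul_pos_right h (Real.exp_pos _).le
  simpa using this

theorem re_exp_mul_evalPolar {n : ℕ} (f : LaurentPoly n) (u x : Fin n → ℝ) (φ : ℝ) :
    (exp (φ * I) * evalPolar f u x).re = ∑ α ∈ f.coeff.support,
      ‖f.coeff α‖ * Real.exp (pairing α u) * Real.cos (φ + phaseAngle f α x) := by
  rw [evalPolar, Finset.mul_sum, re_sum]
  refine Finset.sum_congr rfl fun α _ => ?_
  rw [mul_left_comm, re_ofReal_mul, re_exp_mul_exp]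

theorem re_exp_mul_evalPolar_pos {n : ℕ} {f : LaurentPoly n} (hf : f.coeff.support.Nonempty)
    {x : Fin n → ℝ} {φ : ℝ} (h : ∀ α ∈ f.coeff.support, 0 < Real.cos (φ + phaseAngle f α x))
    (u : Fin n → ℝ) : 0 < (exp (φ * I) * evalPolar f u x).re := by
  rw [re_exp_mul_evalPolar]
  refine Finset.sum_pos (fun α hα => ?_) hf
  have := h α hα
  have := norm_pos_iff.2 (Finsupp.mem_support_iff.1 hα)
  positivity

/-- Far out in a direction exposing the exponent `v`, the monomial of `v` dominates, uniformly
in the arguments. -/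
theorem exists_re_exp_neg_mul_evalPolar_pos {n : ℕ} {f : LaurentPoly n} {v : Fin n → ℤ}
    (hv : v ∈ f.coeff.support) {l : Fin n → ℝ}
    (hl : ∀ α ∈ f.coeff.support, α ≠ v → pairing α l < pairing v l) :
    ∃ u : Fin n → ℝ, ∀ x,
      0 < (exp ((-phaseAngle f v x : ℝ) * I) * evalPolar f u x).re := by
  have hlim : Filter.Tendsto
      (fun r : ℝ => ∑ α ∈ f.coeff.support.erase v,
        ‖f.coeff α‖ * Real.exp (r * (pairing α l - pairing v l))) Filter.atTop (nhds 0) := by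
    rw [← Finset.sum_const_zero (s := f.coeff.support.erase v)]
    refine tendsto_finsetSum _ fun α hα => ?_
    have hneg := sub_neg.2 (hl α (Finset.mem_of_mem_erase hα) (Finset.ne_of_mem_erase hα))
    have := (Real.tendsto_exp_atBot.comp (Filter.tendsto_id.atTop_mul_const_of_neg hneg)).const_mul
      ‖f.coeff α‖
    simpa using this
  have hpos := norm_pos_iff.2 (Finsupp.mem_support_iff.1 hv)
  -- After division by the exponential factor of `v`, the other moduli together stay below `‖f.coeff
  -- v‖`.
  obtain ⟨r, hr⟩ := (hlim.eventually (isOpen_Iio.mem_nhds hpos)).exists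
  refine ⟨r • l, fun x => ?_⟩
  rw [re_exp_mul_evalPolar, ← Finset.add_sum_erase _ _ hv, neg_add_cancel, Real.cos_zero, mul_one]
  have hexp := Real.exp_pos (pairing v (r • l))
  have hb : -(∑ α ∈ f.coeff.support.erase v,
        ‖f.coeff α‖ * Real.exp (r * (pairing α l - pairing v l))) * Real.exp (pairing v (r • l))
      ≤ ∑ α ∈ f.coeff.support.erase v, ‖f.coeff α‖ * Real.exp (pairing α (r • l)) *
        Real.cos (-phaseAngle f v x + phaseAngle f α x) := by
    rw [← Finset.sum_neg_distrib, Finset.sum_mul]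
    refine Finset.sum_le_sum fun α _ => ?_
    have e : Real.exp (r * (pairing α l - pairing v l)) * Real.exp (pairing v (r • l))
        = Real.exp (pairing α (r • l)) := by
      rw [← Real.exp_add]; congr 1; simp only [pairing_smul]; ring
    rw [neg_mul, mul_assoc, e]
    have h1 := Real.neg_one_le_cos (-phaseAngle f v x + phaseAngle f α x)
    have h2 : 0 ≤ ‖f.coeff α‖ * Real.exp (pairing α (r • l)) := by positivity
    nlinarith
  have hr' := mul_pos (sub_pos.2 (show _ < ‖f.coeff v‖ from hr)) hexp
  nlinarith

/-! ### Exposed points -/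

/-- A finite set lies in the convex hull of those of its points that are the unique maximizers
of some continuous linear functional. -/
theorem subset_convexHull_unique_maximizers {V : Type*} [AddCommGroup V] [Module ℝ V]
    [TopologicalSpace V] [T2Space V] [IsTopologicalAddGroup V] [ContinuousSMul ℝ V]
    [LocallyConvexSpace ℝ V] {s : Set V} (hs : s.Finite) :
    s ⊆ convexHull ℝ {v ∈ s | ∃ l : V →L[ℝ] ℝ, ∀ w ∈ s, w ≠ v → l w < l v} := by
  have hext : (convexHull ℝ s).extremePoints ℝ ⊆ s := extremePoints_convexHull_subset
  have hsub : (convexHull ℝ s).extremePoints ℝ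
      ⊆ {v ∈ s | ∃ l : V →L[ℝ] ℝ, ∀ w ∈ s, w ≠ v → l w < l v} := by
    intro v hv
    refine ⟨hext hv, ?_⟩
    have hnot := (((convex_convexHull ℝ s).mem_extremePoints_iff_mem_sdiff_convexHull_sdiff).1 hv).2
    have hnot' : v ∉ convexHull ℝ (s \ {v}) := fun h =>
      hnot (convexHull_mono (Set.sdiff_subset_sdiff_left (subset_convexHull ℝ s)) h)
    obtain ⟨l, u, h1, h2⟩ := geometric_hahn_banach_closed_point (convex_convexHull ℝ _)
      (hs.sdiff.isCompact_convexHull ℝ).isClosed hnot'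
    exact ⟨l, fun w hw hne => (h1 w (subset_convexHull ℝ _ ⟨hw, hne⟩)).trans h2⟩
  calc s ⊆ convexHull ℝ s := subset_convexHull ℝ s
    _ = closure (convexHull ℝ ((convexHull ℝ s).extremePoints ℝ)) :=
      (closure_convexHull_extremePoints (hs.isCompact_convexHull ℝ) (convex_convexHull ℝ s)).symm
    _ = convexHull ℝ ((convexHull ℝ s).extremePoints ℝ) :=
      ((hs.subset hext).isCompact_convexHull ℝ).isClosed.closure_eq
    _ ⊆ _ := convexHull_mono hsub

/-- A bound on an affine function at the exposed exponents holds at all exponents. -/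
theorem abs_add_pairing_lt {n : ℕ} (s : Finset (Fin n → ℤ)) (c r : ℝ) (x : Fin n → ℝ)
    (h : ∀ v ∈ s, (∃ l : Fin n → ℝ, ∀ α ∈ s, α ≠ v → pairing α l < pairing v l) →
      |c + pairing v x| < r) {α : Fin n → ℤ} (hα : α ∈ s) : |c + pairing α x| < r := by
  let ρ : (Fin n → ℤ) → (Fin n → ℝ) := fun β i => (β i : ℝ)
  have hρ : Function.Injective ρ := fun a b hab =>
    funext fun i => Int.cast_injective (congrFun hab i)
  let A : (Fin n → ℝ) → ℝ := fun w => ∑ i, w i * x i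
  have hA : IsLinearMap ℝ A :=
    ⟨fun a b => by simp [A, add_mul, Finset.sum_add_distrib],
      fun a b => by simp [A, Finset.mul_sum, mul_assoc]⟩
  have hconv : Convex ℝ {w | |c + A w| < r} := by
    have : {w | |c + A w| < r} = A ⁻¹' (Set.Ioo (-r - c) (r - c)) := by
      ext w
      simp only [Set.mem_ofPred_eq, abs_lt, Set.mem_preimage, Set.mem_Ioo]
      constructor <;> rintro ⟨h1, h2⟩ <;> constructor <;> linarith
    rw [this]
    exact (convex_Ioo _ _).is_linear_preimage hA
  have hmem := subset_convexHull_unique_maximizers (s.finite_toSet.image ρ) ⟨α, hα, rfl⟩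
  refine convexHull_min ?_ hconv hmem
  rintro _ ⟨⟨v, hv, rfl⟩, l, hl⟩
  refine h v hv ⟨fun i => l (Pi.single i 1), fun β hβ hne => ?_⟩
  have e : ∀ β : Fin n → ℤ, pairing β (fun i => l (Pi.single i 1)) = l (ρ β) := by
    intro β
    have : ρ β = ∑ i, (β i : ℝ) • (Pi.single i 1 : Fin n → ℝ) := by
      rw [← pi_eq_sum_univ' (ρ β)]
    rw [this, map_sum]
    simp [pairing]
  rw [e, e]
  exact hl _ ⟨β, hβ, rfl⟩ (hρ.ne hne)


/-! ### Comparing the branches of the phases at the ends of a path -/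

/-- If `x` is strictly lopsided, a continuous argument `Λ` of `u ↦ f (e ^ (u + i x))` and suitable
branches of all the phases lie in a common open half-plane. -/
theorem exists_branches {n : ℕ} {f : LaurentPoly n} (hf : f.coeff.support.Nonempty)
    {x : Fin n → ℝ} (hx : StrictlyLopsidedAt f x) {L : (Fin n → ℝ) → ℂ} (hL : Continuous L)
    (hexp : ∀ u, exp (L u) = evalPolar f u x) :
    ∃ (φ : ℝ) (a : (Fin n → ℤ) → ℤ),
      (∀ α ∈ f.coeff.support, |φ + phaseAngle f α x - 2 * Real.pi * a α| < Real.pi / 2) ∧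
      ∀ v ∈ f.coeff.support, ∀ u, ∀ m : ℤ,
        |-phaseAngle f v x + (L u).im - 2 * Real.pi * m| < Real.pi / 2 → a v = -m := by
  obtain ⟨φ, hφ⟩ := hx
  obtain ⟨M, hM⟩ := exists_int_forall_abs_sub_lt_of_cos_pos
    (g := fun u => φ + (L u).im) (by fun_prop) fun u => cos_add_im_pos_of_re_pos (by
      rw [hexp]; exact re_exp_mul_evalPolar_pos hf hφ u)
  have hb : ∀ α, ∃ b : ℤ, α ∈ f.coeff.support →
      |φ + phaseAngle f α x - 2 * Real.pi * b| < Real.pi / 2 := by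
    intro α
    by_cases hα : α ∈ f.coeff.support
    · obtain ⟨b, hb⟩ := exists_int_abs_sub_lt_of_cos_pos (hφ α hα)
      exact ⟨b, fun _ => hb⟩
    · exact ⟨0, fun h => absurd h hα⟩
  choose b hb using hb
  -- The shift by `M` places `φ + (L u).im` within `π / 2` of `0`, tying the branches to `L` rather
  -- than to the choice of `φ`.
  refine ⟨φ - 2 * Real.pi * M, fun α => b α - M, fun α hα => ?_, fun v hv u m hm => ?_⟩
  · have h := hb α hα
    push_cast
    rwa [show φ - 2 * Real.pi * M + phaseAngle f α x - 2 * Real.pi * (b α - M)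
      = φ + phaseAngle f α x - 2 * Real.pi * b α by ring]
  -- Three errors below `π / 2` add up to less than `2π`.
  · refine int_eq_of_abs_two_pi_mul_sub_lt ?_
    have h1 := abs_lt.1 (hb v hv)
    have h2 := abs_lt.1 (hM u)
    have h3 := abs_lt.1 hm
    have := Real.pi_pos
    push_cast
    exact abs_lt.2 ⟨by linarith, by linarith⟩

/-- With common branches, the shifted phases are affine along the segment and stay in the convex
interval `(-π/2, π/2)`. -/
theorem strictlyLopsidedAt_lineMap {n : ℕ} {f : LaurentPoly n} {x y : Fin n → ℝ} {φ ψ : ℝ}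
    {a : (Fin n → ℤ) → ℤ}
    (hx : ∀ α ∈ f.coeff.support, |φ + phaseAngle f α x - 2 * Real.pi * a α| < Real.pi / 2)
    (hy : ∀ α ∈ f.coeff.support, |ψ + phaseAngle f α y - 2 * Real.pi * a α| < Real.pi / 2)
    {t : ℝ} (ht : t ∈ Set.Icc (0 : ℝ) 1) :
    StrictlyLopsidedAt f ((1 - t) • x + t • y) := by
  refine ⟨(1 - t) * φ + t * ψ, fun α hα => ?_⟩
  have h := convex_Ioo (-(Real.pi / 2)) (Real.pi / 2) (abs_lt.1 (hx α hα)) (abs_lt.1 (hy α hα))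
    (sub_nonneg.2 ht.2) ht.1 (by ring)
  have e : (1 - t) * φ + t * ψ + phaseAngle f α ((1 - t) • x + t • y)
      = (1 - t) • (φ + phaseAngle f α x - 2 * Real.pi * a α)
        + t • (ψ + phaseAngle f α y - 2 * Real.pi * a α) + a α * (2 * Real.pi) := by
    simp only [phaseAngle, pairing_add, pairing_smul, smul_eq_mul]; ring
  rw [e, Real.cos_add_int_mul_two_pi]
  exact Real.cos_pos_of_mem_Ioo h

/-- Strictly lopsided endpoints of a path avoiding the coamoeba are joined by a segment of
strictly lopsided points. -/
theorem strictlyLopsidedAt_segment {n : ℕ} {f : LaurentPoly n} (hf : f.coeff.support.Nonempty)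
    {θ : ℝ → Fin n → ℝ} (hθ : Continuous θ) (hco : ∀ t, toTorus (θ t) ∉ coamoeba f)
    (h0 : StrictlyLopsidedAt f (θ 0)) (h1 : StrictlyLopsidedAt f (θ 1))
    {t : ℝ} (ht : t ∈ Set.Icc (0 : ℝ) 1) :
    StrictlyLopsidedAt f ((1 - t) • θ 0 + t • θ 1) := by
  obtain ⟨L, hL, hexp⟩ := exists_continuous_log (X := (Fin n → ℝ) × ℝ)
    (F := fun p => evalPolar f p.1 (θ p.2))
    (continuous_evalPolar f continuous_fst (hθ.comp continuous_snd))
    fun p => evalPolar_ne_zero (hco p.2) p.1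
  obtain ⟨φ, a, ha, hav⟩ := exists_branches hf h0 (L := fun u => L (u, 0)) (by fun_prop)
    fun u => hexp (u, 0)
  obtain ⟨ψ, b, hb, hbv⟩ := exists_branches hf h1 (L := fun u => L (u, 1)) (by fun_prop)
    fun u => hexp (u, 1)
  have hvert : ∀ v ∈ f.coeff.support,
      (∃ l : Fin n → ℝ, ∀ α ∈ f.coeff.support, α ≠ v → pairing α l < pairing v l) →
      a v = b v := by
    rintro v hv ⟨l, hl⟩
    obtain ⟨u, hu⟩ := exists_re_exp_neg_mul_evalPolar_pos hv hl
    have hP : Continuous fun t => phaseAngle f v (θ t) := (continuous_phaseAngle f v).comp hθ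
    -- A single `m` serves the whole path, so it determines the branch of `v` at both ends.
    obtain ⟨m, hm⟩ := exists_int_forall_abs_sub_lt_of_cos_pos
      (g := fun t => -phaseAngle f v (θ t) + (L (u, t)).im) (by fun_prop)
      fun t => cos_add_im_pos_of_re_pos (by rw [hexp]; exact hu (θ t))
    rw [hav v hv u m (hm 0), hbv v hv u m (hm 1)]
  have hdiff : ∀ α ∈ f.coeff.support,
      |(φ - ψ) + pairing α (θ 0 - θ 1) - (2 * Real.pi * a α - 2 * Real.pi * b α)|
        < Real.pi := by
    intro α hα
    have e1 := abs_lt.1 (ha α hα)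
    have e2 := abs_lt.1 (hb α hα)
    have e3 : pairing α (θ 0) = pairing α (θ 0 - θ 1) + pairing α (θ 1) := by
      rw [← pairing_add, sub_add_cancel]
    simp only [phaseAngle] at e1 e2
    exact abs_lt.2 ⟨by linarith, by linarith⟩
  have hab : ∀ α ∈ f.coeff.support, a α = b α := by
    intro α hα
    have e1 := abs_lt.1 (hdiff α hα)
    -- At vertices the branch terms in `hdiff` cancel, which leaves an affine function of the
    -- exponent.
    have e2 := abs_lt.1 (abs_add_pairing_lt f.coeff.support (φ - ψ) Real.pi (θ 0 - θ 1)
      (fun v hv hl => by simpa [hvert v hv hl] using hdiff v hv) hα)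
    exact int_eq_of_abs_two_pi_mul_sub_lt (abs_lt.2 ⟨by linarith, by linarith⟩)
  exact strictlyLopsidedAt_lineMap ha (fun α hα => by rw [hab α hα]; exact hb α hα) ht

/-! ### Components -/

instance : LocallyPathConnectedSpace Real.Angle :=
  (isQuotientMap_quot_mk (r := (QuotientAddGroup.leftRel
    (AddSubgroup.zmultiples (2 * Real.pi))).r)).locallyPathConnectedSpace

/-- Two points outside the closed lopsided coamoeba that are joined outside the coamoeba lie in
the same component of the complement of the closed lopsided coamoeba. -/
theorem connectedComponentIn_eq_of_joinedIn {n : ℕ} {f : LaurentPoly n} {p q : Torus n}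
    (hp : p ∈ (closure (lopsidedCoamoeba f))ᶜ) (hq : q ∈ (closure (lopsidedCoamoeba f))ᶜ)
    (h : JoinedIn (coamoeba f)ᶜ p q) :
    connectedComponentIn (closure (lopsidedCoamoeba f))ᶜ p
      = connectedComponentIn (closure (lopsidedCoamoeba f))ᶜ q := by
  obtain ⟨γ, hγ⟩ := h
  obtain ⟨θ, hθ, hlift⟩ := exists_toTorus_lift γ.continuous_extend
  have e0 : toTorus (θ 0) = p := by rw [hlift, γ.extend_zero]
  have e1 : toTorus (θ 1) = q := by rw [hlift, γ.extend_one]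
  have hf : f.coeff.support.Nonempty := by
    rw [← e0] at hp
    obtain ⟨-, -, α, hα, -⟩ :=
      exists_cos_of_notMem_lopsidedCoamoeba fun hx => hp (subset_closure hx)
    exact ⟨α, hα⟩
  have hco : ∀ t, toTorus (θ t) ∉ coamoeba f := fun t => by
    rw [hlift]; exact hγ _
  have hseg : ∀ t ∈ Set.Icc (0 : ℝ) 1, StrictlyLopsidedAt f ((1 - t) • θ 0 + t • θ 1) :=
    fun t ht => strictlyLopsidedAt_segment hf hθ hco
      (strictlyLopsidedAt_of_notMem_closure (by rwa [e0]))
      (strictlyLopsidedAt_of_notMem_closure (by rwa [e1])) ht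
  let c : ℝ → Torus n := fun t => toTorus ((1 - t) • θ 0 + t • θ 1)
  have hc : Continuous c := continuous_toTorus.comp (by fun_prop)
  have hpre : IsPreconnected (c '' Set.Icc 0 1) := isPreconnected_Icc.image c hc.continuousOn
  have hpc : p ∈ c '' Set.Icc 0 1 := ⟨0, by simp, by simp [c, e0]⟩
  have hqc : q ∈ c '' Set.Icc 0 1 := ⟨1, by simp, by simp [c, e1]⟩
  refine connectedComponentIn_eq (hpre.subset_connectedComponentIn hpc ?_ hqc)
  rintro _ ⟨t, ht, rfl⟩
  exact (hseg t ht).notMem_closure hf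

end Coamoeba

theorem proposition3p8 (n : ℕ) (f : Coamoeba.LaurentPoly n) (E : Set (Coamoeba.Torus n))
    (hE : E ∈ Coamoeba.complementComponents (closure (Coamoeba.coamoeba f))) :
    {Θ | Θ ∈ Coamoeba.complementComponents (closure (Coamoeba.lopsidedCoamoeba f)) ∧
      Θ ⊆ E}.Subsingleton := by
  obtain ⟨x, hx, rfl⟩ := hE
  rintro _ ⟨⟨p, hp, rfl⟩, hpE⟩ _ ⟨⟨q, hq, rfl⟩, hqE⟩
  have hopen : IsOpen (connectedComponentIn (closure (Coamoeba.coamoeba f))ᶜ x) :=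
    isClosed_closure.isOpen_compl.connectedComponentIn
  -- The torus is locally path connected, so its open connected subsets are path connected.
  have hpath := hopen.isConnected_iff_isPathConnected.1 (isConnected_connectedComponentIn_iff.2 hx)
  refine Coamoeba.connectedComponentIn_eq_of_joinedIn hp hq ?_
  exact (hpath.joinedIn p (hpE (mem_connectedComponentIn hp)) q
    (hqE (mem_connectedComponentIn hq))).mono ((connectedComponentIn_subset _ _).trans
      (Set.compl_subset_compl.2 subset_closure))
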